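/- Let $T=T^m=U(1)^m$ with $m\ge 1$. For a compact, second-countable Hausdorff space $X$ with a continuous effective $T$-action all of whose isotropy groups are subtori, and integers $l\ge 0$, $m\ge n\ge 0$, filter $X$ by orbit dimension, $X_{l+2i+1+(m-n)}=X_{l+2i+(m-n)}=\{x\mid \dim T(x)\le i+(m-n)\}$ for $0\le i\le n$, and filter the orbit space $Q=X/T$ by $Q_{l+i}=X_{l+2i+(m-n)}/T$; assume that $(X,(X_j)_j)$ is a topological stratified pseudomanifold with lowest nonempty skeleton $X_{l+(m-n)}$, that no orbit has dimension less than $m-n$, and, if $l+n\neq 0$, that $X$ has free orbits. Such an $X$ is, by recursion on $l+n$, an $(l+m+n)$-dimensional *locally standard $T$-pseudomanifold* if: for $l=n=0$ it is a finite disjoint union of copies of $T$ with the multiplication action; otherwise every $x$ with $\dim T(x)=i+(m-n)$ has a $T$-invariant open neighborhood weakly equivariantly homeomorphic to $O\times(\Omega\times U(1)^{m-n})\times \mathring c(L_x)$, where $O\subset\mathbb R^l$ is open and contractible, $\Omega\subset(\mathbb C^\times)^i$ is open and $U(1)^i$-invariant, $L_x$ is a compact $(2n-2i-1)$-dimensional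 locally standard $T_x$-pseudomanifold (empty if $i=n$), $\mathring c$ is the open cone, and $T\cong T/T_x\times T_x\cong U(1)^{i+(m-n)}\times T^{n-i}$ acts by multiplication on $\Omega\times U(1)^{m-n}$ and through $L_x$ on $\mathring c(L_x)$. If $X$ is connected, $l=0$ and $n=1$, then $Q$ is a finite graph (loops and multiple edges allowed), and $X$ is called a locally standard $T$-pseudomanifold *over a graph*. The strata of $Q$ are the connected components of $Q_k\setminus Q_{k-1}$, and there is a morphism $S\to S'$ of strata whenever $S\subset\overline{S'}$. Put $\mathring Q=Q_{l+n}\setminus Q_{l+n-1}$. The *characteristic data* of $X$ are the triple $(Q,\lambda,c)$, where the characteristic functor $\lambda$ assigns to a stratum $S$ the isotropy subgroup of the points of $X$ over $S$, and $c\in H^2(\mathring Q;\mathbb Z^m)$ is the Chern class of the principal $T$-bundle of free orbits over $\mathring Q$. A *weak isomorphism* $(Q,\lambda,c)\to(Q',\lambda',c')$ is a homeomorphism $f:Q\to Q'$ with $f(Q_k)=Q'_k$ for all $k$ and $c=(f|_{\mathring Q})^*c'$, for which there is an automorphism $\psi$ of the topological group $T$ with $\psi(\lambda(S))=\lambda'(f(S))$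 for all strata $S$; it is an *isomorphism* if $\psi=\mathrm{id}$ can be taken. A *weakly* $T$-equivariant homeomorphism $h:X\to X'$ is a homeomorphism with $h(tx)=\psi(t)h(x)$ for some automorphism $\psi$ of $T$ and all $t,x$; it is $T$-equivariant if $\psi=\mathrm{id}$. **Theorem.** Let $X$ and $X'$ be (connected) locally standard $T$-pseudomanifolds over graphs. Then their Chern classes vanish, so that their characteristic data are of the form $(Q,\lambda,0)$ and $(Q',\lambda',0)$, and: 1. $(Q,\lambda,0)$ and $(Q',\lambda',0)$ are isomorphic if and only if $X$ and $X'$ are $T$-equivariantly homeomorphic; 2. $(Q,\lambda,0)$ and $(Q',\lambda',0)$ are weakly isomorphic if and only if $X$ and $X'$ are weakly $T$-equivariantly homeomorphic. No homotopy equivalence condition (that $\mathring Q\hookrightarrow Q$ be a homotopy equivalence) is assumed. -/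

import Mathlib

open Set Topology

section StratifiedPseudomanifolds

universe u

/-! ### Filtered spaces and strata -/

/-- `F` is a filtration of `Q` of lowest index `l` and length `n`:
`Q = F (l+n) ⊋ F (l+n-1) ⊇ ... ⊇ F l ⊋ F (l-1) = ∅`, by closed subsets of a nonempty
Hausdorff space.  The indexing is extended to `ℤ`, by `∅` below `l` and by `Q` above `l+n`. -/
def IsFilteredSpace (l n : ℕ) (Q : Type u) [TopologicalSpace Q] (F : ℤ → Set Q) : Prop :=
  T2Space Q ∧ Nonempty Q ∧ Monotone F ∧ (∀ k, IsClosed (F k)) ∧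
    (∀ k < (l : ℤ), F k = ∅) ∧ (F l).Nonempty ∧
    F (l + n) = univ ∧ F (l + n - 1) ≠ univ

/-- `S` is a stratum of dimension `k`: a connected component of `F k \ F (k-1)`. -/
def IsStratumOfDim {Q : Type u} [TopologicalSpace Q] (F : ℤ → Set Q) (k : ℤ) (S : Set Q) : Prop :=
  ∃ x ∈ F k \ F (k - 1), S = connectedComponentIn (F k \ F (k - 1)) x

/-- `S` is, with the subspace topology, a topological manifold of dimension `d`. -/
def IsTopManifold {Q : Type u} [TopologicalSpace Q] (d : ℕ) (S : Set Q) : Prop :=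
  T2Space S ∧ SecondCountableTopology S ∧ Nonempty (ChartedSpace (EuclideanSpace ℝ (Fin d)) S)

/-! ### Open cones -/

/-- The height of a point of `{vertex} ⊔ L × [0,1)`. -/
def coneHeight {L : Type u} : Unit ⊕ (L × Ico (0 : ℝ) 1) → ℝ
  | Sum.inl _ => 0
  | Sum.inr p => p.2

/-- All points of height `0` are identified. -/
def coneSetoid (L : Type u) : Setoid (Unit ⊕ (L × Ico (0 : ℝ) 1)) where
  r a b := a = b ∨ (coneHeight a = 0 ∧ coneHeight b = 0)
  iseqv := by
    refine ⟨fun a => Or.inl rfl, ?_, ?_⟩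
    · rintro a b (h | h)
      · exact Or.inl h.symm
      · exact Or.inr ⟨h.2, h.1⟩
    · rintro a b c (rfl | h) (rfl | h')
      · exact Or.inl rfl
      · exact Or.inr h'
      · exact Or.inr h
      · exact Or.inr ⟨h.1, h'.2⟩

/-- The open cone `L × [0,1) / L × {0}`.  The additional point, which is identified with
`L × {0}`, only serves to make the open cone on the empty space a single point. -/
def OpenCone (L : Type u) : Type u := Quotient (coneSetoid L)

instance (L : Type u) [TopologicalSpace L] : TopologicalSpace (OpenCone L) :=
  inferInstanceAs (TopologicalSpace (Quotient (coneSetoid L)))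

/-- The vertex of the open cone. -/
def OpenCone.vertex (L : Type u) : OpenCone L := Quotient.mk (coneSetoid L) (Sum.inl ())

/-- The point `[x, s]` of the open cone. -/
def OpenCone.mk {L : Type u} (x : L) (s : Ico (0 : ℝ) 1) : OpenCone L :=
  Quotient.mk (coneSetoid L) (Sum.inr (x, s))

/-- The open cone on a subset `A` of `L`, as a subset of the open cone on `L`
(the vertex alone if `A` is empty). -/
def OpenCone.ofSet {L : Type u} (A : Set L) : Set (OpenCone L) :=
  {z | z = OpenCone.vertex L ∨ ∃ x ∈ A, ∃ s, z = OpenCone.mk x s}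

/-- The map `[x, s] ↦ [f x, s]` of open cones. -/
def OpenCone.map {L : Type u} (f : L → L) : OpenCone L → OpenCone L :=
  Quotient.map' (s₁ := coneSetoid L) (s₂ := coneSetoid L)
    (Sum.map id (fun p => (f p.1, p.2))) (by
      have key : ∀ a : Unit ⊕ (L × Ico (0 : ℝ) 1),
          coneHeight (Sum.map id (fun p : L × Ico (0 : ℝ) 1 => (f p.1, p.2)) a)
            = coneHeight a := by
        rintro (a | a) <;> rfl
      rintro a b (h | h)
      · exact Or.inl (by rw [h])
      · exact Or.inr ⟨by rw [key]; exact h.1, by rw [key]; exact h.2⟩)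

/-! ### Topological stratified pseudomanifolds -/

/-- `(Q, F)` is an `(l+n)`-dimensional topological stratified pseudomanifold with lowest
index `l` and length `n`.  The definition is by recursion on the dimension `l + n`:
the link of a point of a stratum of dimension `l + i` is either empty, if `i = n`, or a compact
topological stratified pseudomanifold of dimension `l' + n' = n - i - 1`. -/
def IsTopStratPseudomanifold (l n : ℕ) (Q : Type u) [TopologicalSpace Q] (F : ℤ → Set Q) : Prop :=
  IsFilteredSpace l n Q F ∧
  if l + n = 0 then DiscreteTopology Q
  else
    (∀ i : ℕ, i ≤ n → ∀ S : Set Q, IsStratumOfDim F (l + i) S → IsTopManifold (l + i) S) ∧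
    Dense (F (l + n) \ F (l + n - 1)) ∧
    ∀ i : ℕ, i ≤ n → ∀ p ∈ F (l + i) \ F (l + i - 1),
      ∃ (U : Set Q) (L : Type u) (_ : TopologicalSpace L) (G : ℤ → Set L)
        (O : Set (EuclideanSpace ℝ (Fin (l + i)))) (φ : U ≃ₜ O × OpenCone L),
        IsOpen U ∧ p ∈ U ∧ CompactSpace L ∧
        ((i = n ∧ IsEmpty L) ∨
          ∃ l' n' : ℕ, ∃ _ : l' + n' + i + 1 = n, IsTopStratPseudomanifold l' n' L G) ∧
        IsOpen O ∧ ContractibleSpace O ∧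
        ∀ j : ℤ, -1 ≤ j → j ≤ n - i - 1 →
          φ '' {y | (y : Q) ∈ F (l + i + j + 1)} = {z | z.2 ∈ OpenCone.ofSet (G j)}
termination_by l + n
decreasing_by omega

end StratifiedPseudomanifolds

section TorusActions

universe u

/-! ### Torus actions and the filtration by orbit dimension -/

/-- The torus `T^m = U(1)^m`. -/
abbrev Torus (m : ℕ) : Type := Fin m → Circle

/-- The orbit `T(x) ≅ T^m / T_x` has dimension at most `d`: the isotropy subgroup `T_x` is a
torus of some dimension `r`, and `m - r ≤ d`. -/
def OrbitDimLE (m : ℕ) {X : Type u} [MulAction (Torus m) X] (x : X) (d : ℤ) : Prop :=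
  ∃ r : ℕ, Nonempty (MulAction.stabilizer (Torus m) x ≃ₜ* Torus r) ∧ (m : ℤ) - r ≤ d

/-- The filtration by orbit dimension:
`X_{l+2i+1+(m-n)} = X_{l+2i+(m-n)} = {x | dim T(x) ≤ i + (m-n)}`. -/
def orbitSkel (l n m : ℕ) (X : Type u) [MulAction (Torus m) X] (k : ℤ) : Set X :=
  {x | ∃ i : ℤ, l + 2 * i + (m - n) ≤ k ∧ OrbitDimLE m x (i + (m - n))}

/-- `X` is an `(l+m+n)`-dimensional locally standard `T^m`-pseudomanifold, with respect to its
filtration by orbit dimension.  The definition is by recursion on `l + n`: the link of a point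
whose orbit has dimension `i + (m-n)` is either empty, if `i = n`, or a locally standard
`T^{n-i}`-pseudomanifold of dimension `l' + (n - i) + n' = 2 n - 2 i - 1`.
The isomorphism `α` is `T^m ≅ T^m / T_x × T_x ≅ U(1)^{i+(m-n)} × T^{n-i}`. -/
def IsLocallyStandard (l n m : ℕ) (X : Type u) [TopologicalSpace X] [MulAction (Torus m) X] :
    Prop :=
  T2Space X ∧ CompactSpace X ∧ SecondCountableTopology X ∧
  ContinuousSMul (Torus m) X ∧ FaithfulSMul (Torus m) X ∧
  (∀ x : X, IsConnected (MulAction.stabilizer (Torus m) x : Set (Torus m)) ∧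
    IsClosed (MulAction.stabilizer (Torus m) x : Set (Torus m))) ∧
  n ≤ m ∧
  IsTopStratPseudomanifold (l + (m - n)) (2 * n) X (orbitSkel l n m X) ∧
  orbitSkel l n m X (l - 1 + (m - n)) = ∅ ∧
  (l + n ≠ 0 → orbitSkel l n m X (l + m + n - 2) ≠ univ) ∧
  if l + n = 0 then
    ∃ (r : ℕ) (e : X ≃ₜ Fin r × Torus m),
      ∀ (t : Torus m) (x : X), e (t • x) = ((e x).1, t * (e x).2)
  else
    ∀ i : ℕ, i ≤ n →
      ∀ x ∈ orbitSkel l n m X (l + 2 * i + (m - n)) \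
          orbitSkel l n m X (l + 2 * (i - 1) + (m - n)),
      ∃ (U : Set X) (L : Type u) (_ : TopologicalSpace L) (_ : MulAction (Torus (n - i)) L)
        (O : Set (EuclideanSpace ℝ (Fin l))) (Ω : Set (Fin i → ℂ))
        (α : Torus m ≃ₜ* (Torus i × Torus (m - n)) × Torus (n - i))
        (φ : U ≃ₜ O × (Ω × Torus (m - n)) × OpenCone L),
        IsOpen U ∧ x ∈ U ∧ (∀ t : Torus m, ∀ y ∈ U, t • y ∈ U) ∧
        ((i = n ∧ IsEmpty L) ∨
          ∃ l' n' : ℕ, ∃ _ : l' + n' + i + 1 = n, IsLocallyStandard l' n' (n - i) L) ∧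
        IsOpen O ∧ ContractibleSpace O ∧
        IsOpen Ω ∧ (∀ w ∈ Ω, ∀ j, w j ≠ 0) ∧
        (∀ u : Torus i, ∀ w ∈ Ω, (fun j => (u j : ℂ) * w j) ∈ Ω) ∧
        (∀ t : Torus m, t • x = x ↔ (α t).1 = 1) ∧
        ∀ (t : Torus m) (y y' : U), (y' : X) = t • (y : X) →
          (φ y').1 = (φ y).1 ∧
          (∀ j, ((φ y').2.1.1 : Fin i → ℂ) j
            = ((α t).1.1 j : ℂ) * ((φ y).2.1.1 : Fin i → ℂ) j) ∧
          (φ y').2.1.2 = (α t).1.2 * (φ y).2.1.2 ∧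
          (φ y').2.2 = OpenCone.map (fun z : L => (α t).2 • z) (φ y).2.2
termination_by l + n
decreasing_by omega

/-! ### The filtered orbit space -/

/-- The orbit space `Q = X / T^m`, with the quotient topology. -/
abbrev OrbitSpace (m : ℕ) (X : Type u) [MulAction (Torus m) X] : Type u :=
  MulAction.orbitRel.Quotient (Torus m) X

/-- The orbit projection. -/
noncomputable def orbitProj (m : ℕ) {X : Type u} [MulAction (Torus m) X] (x : X) : OrbitSpace m X :=
  Quotient.mk (MulAction.orbitRel (Torus m) X) x

/-- The filtration of the orbit space: `Q_{l+i} = X_{l+2i+(m-n)} / T`. -/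
def orbitSpaceSkel (l n m : ℕ) (X : Type u) [MulAction (Torus m) X] (k : ℤ) :
    Set (OrbitSpace m X) :=
  orbitProj m '' orbitSkel l n m X (l + 2 * (k - l) + (m - n))

/-! ### The category of strata and the characteristic functor -/

/-- The strata of a filtered space. -/
def Strata {Q : Type u} [TopologicalSpace Q] (F : ℤ → Set Q) : Type u :=
  {S : Set Q // ∃ k, IsStratumOfDim F k S}

/-- There is a morphism `S → S'` whenever `S ⊆ closure S'`. -/
instance {Q : Type u} [TopologicalSpace Q] (F : ℤ → Set Q) : Preorder (Strata F) where
  le S S' := S.1 ⊆ closure S'.1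
  le_refl _ := subset_closure
  le_trans _ _ _ h h' := h.trans (closure_minimal h' isClosed_closure)

/-- The characteristic functor `λ : S(Q)ᵒᵖ → {subgroups of T^m}` of `X`, as an order
preserving map.  It sends a stratum `S` to the isotropy subgroup of the points over `S`, written
as the subgroup of all elements which fix every point over `S`. -/
noncomputable def charFunctor (l n m : ℕ) (X : Type u) [TopologicalSpace X] [MulAction (Torus m) X]
    [T2Space X] [ContinuousSMul (Torus m) X] :
    (Strata (orbitSpaceSkel l n m X))ᵒᵈ →o Subgroup (Torus m) where
  toFun S := fixingSubgroup (Torus m) (orbitProj m ⁻¹' (OrderDual.ofDual S).1)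
  monotone' := by
    intro S' S h t ht
    rw [mem_fixingSubgroup_iff] at ht ⊢
    intro x hx
    have hopen : IsOpenMap (orbitProj m : X → OrbitSpace m X) :=
      isOpenMap_quotient_mk'_mul
    have hcl : IsClosed {y : X | t • y = y} :=
      isClosed_eq (continuous_const_smul t) continuous_id
    have h1 : x ∈ closure (orbitProj m ⁻¹' (OrderDual.ofDual S').1) :=
      hopen.preimage_closure_subset_closure_preimage
        ((show (OrderDual.ofDual S).1 ⊆ closure (OrderDual.ofDual S').1 from h) hx)
    exact closure_minimal (fun y hy => ht y hy) hcl h1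

end TorusActions

section Cohomology

universe u v

/-! ### Singular cohomology in degree two -/

/-- Singular `k`-simplices. -/
abbrev SingularSimplex (k : ℕ) (B : Type u) [TopologicalSpace B] : Type u :=
  C(stdSimplex ℝ (Fin (k + 1)), B)

/-- Singular `k`-cochains with coefficients in `A`. -/
abbrev SingularCochain (k : ℕ) (B : Type u) [TopologicalSpace B] (A : Type v) : Type (max u v) :=
  SingularSimplex k B → A

/-- The inclusion of the `i`-th face (the one opposite to the `i`-th vertex) of the standard
simplex. -/
noncomputable def simplexFace (k : ℕ) (i : Fin (k + 2)) :
    C(stdSimplex ℝ (Fin (k + 1)), stdSimplex ℝ (Fin (k + 2))) :=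
  ⟨stdSimplex.map i.succAbove, stdSimplex.continuous_map _⟩

/-- The coboundary of singular cochains. -/
noncomputable def singularCoboundary (k : ℕ) (B : Type u) [TopologicalSpace B]
    (A : Type v) [AddCommGroup A] : SingularCochain k B A →+ SingularCochain (k + 1) B A where
  toFun c τ := ∑ i : Fin (k + 2), (-1 : ℤ) ^ (i : ℕ) • c (τ.comp (simplexFace k i))
  map_zero' := by funext τ; simp
  map_add' c d := by funext τ; simp [Finset.sum_add_distrib]

/-- Singular `2`-cocycles. -/
noncomputable def SingularCocycle2 (B : Type u) [TopologicalSpace B] (A : Type v)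
    [AddCommGroup A] : AddSubgroup (SingularCochain 2 B A) :=
  (singularCoboundary 2 B A).ker

/-- Singular cohomology `H²(B; A)`: cocycles modulo coboundaries. -/
abbrev SingularH2 (B : Type u) [TopologicalSpace B] (A : Type v) [AddCommGroup A] :
    Type (max u v) :=
  SingularCocycle2 B A ⧸ (singularCoboundary 1 B A).range.addSubgroupOf (SingularCocycle2 B A)

/-- Pullback of singular cochains. -/
def SingularCochain.pullback {k : ℕ} {B : Type u} {B' : Type v} [TopologicalSpace B]
    [TopologicalSpace B'] (f : C(B, B')) (A : Type) [AddCommGroup A] :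
    SingularCochain k B' A →+ SingularCochain k B A where
  toFun c σ := c (f.comp σ)
  map_zero' := rfl
  map_add' _ _ := rfl

theorem SingularCochain.coboundary_pullback {k : ℕ} {B : Type u} {B' : Type v}
    [TopologicalSpace B] [TopologicalSpace B'] (f : C(B, B')) (A : Type) [AddCommGroup A]
    (c : SingularCochain k B' A) :
    singularCoboundary k B A (SingularCochain.pullback f A c)
      = SingularCochain.pullback f A (singularCoboundary k B' A c) := rfl

/-- Pullback of `2`-cocycles. -/
noncomputable def SingularCocycle2.pullback {B : Type u} {B' : Type v} [TopologicalSpace B]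
    [TopologicalSpace B'] (f : C(B, B')) (A : Type) [AddCommGroup A] :
    SingularCocycle2 B' A →+ SingularCocycle2 B A :=
  ((SingularCochain.pullback f A).comp (SingularCocycle2 B' A).subtype).codRestrict
    (SingularCocycle2 B A) (by
      rintro ⟨c, hc⟩
      change singularCoboundary 2 B A (SingularCochain.pullback f A c) = 0
      rw [SingularCochain.coboundary_pullback,
        show singularCoboundary 2 B' A c = 0 from hc, map_zero])

/-- The homomorphism `f^* : H²(B'; A) → H²(B; A)`. -/
noncomputable def SingularH2.pullback {B : Type u} {B' : Type v} [TopologicalSpace B]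
    [TopologicalSpace B'] (f : C(B, B')) (A : Type) [AddCommGroup A] :
    SingularH2 B' A →+ SingularH2 B A :=
  QuotientAddGroup.map _ _ (SingularCocycle2.pullback f A) (by
    rintro ⟨c, hc⟩ ⟨b, hb⟩
    exact ⟨SingularCochain.pullback f A b, by
      rw [SingularCochain.coboundary_pullback, hb]; rfl⟩)

end Cohomology

section CharacteristicData

universe u v

/-! ### The Chern class of the free part -/

/-- The union `F N \ F (N-1)` of the top strata of a filtered space of dimension `N`. -/
def topPart {Q : Type u} (N : ℤ) (F : ℤ → Set Q) : Set Q := F N \ F (N - 1)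

/-- The homomorphism `exp : ℝ^m → T^m` with kernel `ℤ^m`. -/
noncomputable def torusExp {m : ℕ} (θ : Fin m → ℝ) : Torus m :=
  fun j => Circle.exp (2 * Real.pi * θ j)

/-- The cochain `c` on the union `B` of the top strata of `Q` is an obstruction cocycle of the
principal `T^m`-bundle `π : π⁻¹(B) → B`.
Choose a point `s b` over every `b ∈ B`, and over every path `σ` in `B` a lift `ℓ σ` between the
chosen points.  For a singular `2`-simplex `τ`, with a lift `τ'`, the three lifted edges are
`exp θ_i • τ'`, and `c τ ∈ π_1(T^m) = ℤ^m` is the winding number of the loop that they form. -/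
def IsObstructionCocycle (l n m : ℕ) (X : Type u) [TopologicalSpace X] [MulAction (Torus m) X]
    (c : SingularCochain 2 (topPart (l + n) (orbitSpaceSkel l n m X)) (Fin m → ℤ)) : Prop :=
  ∃ (s : topPart (l + n) (orbitSpaceSkel l n m X) → X)
    (ℓ : SingularSimplex 1 (topPart (l + n) (orbitSpaceSkel l n m X)) → SingularSimplex 1 X),
    (∀ b, orbitProj m (s b) = b) ∧
    (∀ σ, (∀ x, orbitProj m (ℓ σ x) = σ x) ∧
      ∀ v : Fin 2, ℓ σ (stdSimplex.vertex v) = s (σ (stdSimplex.vertex v))) ∧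
    ∀ τ, ∃ (τ' : SingularSimplex 2 X) (θ : Fin 3 → C(stdSimplex ℝ (Fin 2), Fin m → ℝ)),
      (∀ x, orbitProj m (τ' x) = τ x) ∧
      (∀ i x, ℓ (τ.comp (simplexFace 1 i)) x = torusExp (θ i x) • τ' (simplexFace 1 i x)) ∧
      ∀ j, (c τ j : ℝ) = ∑ i : Fin 3, (-1 : ℝ) ^ (i : ℕ) *
        (θ i (stdSimplex.vertex 1) j - θ i (stdSimplex.vertex 0) j)

/-- `c` is the Chern class `c^free ∈ H²(Q°; ℤ^m)` of the principal `T^m`-bundle `X° → Q°`,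
i.e. the obstruction class to the existence of a section. -/
def IsFreeChernClass (l n m : ℕ) (X : Type u) [TopologicalSpace X] [MulAction (Torus m) X]
    (c : SingularH2 (topPart (l + n) (orbitSpaceSkel l n m X)) (Fin m → ℤ)) : Prop :=
  ∃ z : SingularCocycle2 (topPart (l + n) (orbitSpaceSkel l n m X)) (Fin m → ℤ),
    IsObstructionCocycle l n m X z.1 ∧ QuotientAddGroup.mk z = c

/-! ### Characteristic data -/

/-- Data `(Q, λ, c)` on a filtered space `Q` of dimension `N`: the filtration of `Q`, a functor
`λ` on the opposite of the preorder of strata, and a class `c ∈ H²(Q°; ℤ^m)`. -/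
structure CharData (m : ℕ) (N : ℤ) (Q : Type u) [TopologicalSpace Q] where
  skel : ℤ → Set Q
  char : (Strata skel)ᵒᵈ →o Subgroup (Torus m)
  chern : SingularH2 (topPart N skel) (Fin m → ℤ)

/-- The data `(X / T^m, λ, c)` of a space `X`, where `λ` is the characteristic functor of `X`. -/
noncomputable def charData (l n m : ℕ) (X : Type u) [TopologicalSpace X] [MulAction (Torus m) X]
    [T2Space X] [ContinuousSMul (Torus m) X]
    (c : SingularH2 (topPart (l + n) (orbitSpaceSkel l n m X)) (Fin m → ℤ)) :
    CharData m (l + n) (OrbitSpace m X) where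
  skel := orbitSpaceSkel l n m X
  char := charFunctor l n m X
  chern := c

/-- The homeomorphism `f` is stratified: it carries skeleta onto skeleta. -/
def IsStratifiedHomeo {Q : Type u} {Q' : Type v} [TopologicalSpace Q] [TopologicalSpace Q']
    (F : ℤ → Set Q) (F' : ℤ → Set Q') (f : Q ≃ₜ Q') : Prop :=
  ∀ k, f '' F k = F' k

theorem IsStratifiedHomeo.image_diff {Q : Type u} {Q' : Type v} [TopologicalSpace Q]
    [TopologicalSpace Q'] {F : ℤ → Set Q} {F' : ℤ → Set Q'} {f : Q ≃ₜ Q'}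
    (hf : IsStratifiedHomeo F F' f) (k : ℤ) : f '' (F k \ F (k - 1)) = F' k \ F' (k - 1) := by
  rw [Set.image_sdiff f.injective, hf k, hf (k - 1)]

/-- The map `S(f)` of strata induced by a stratified homeomorphism. -/
def IsStratifiedHomeo.mapStrata {Q : Type u} {Q' : Type v} [TopologicalSpace Q]
    [TopologicalSpace Q'] {F : ℤ → Set Q} {F' : ℤ → Set Q'} {f : Q ≃ₜ Q'}
    (hf : IsStratifiedHomeo F F' f) (S : Strata F) : Strata F' :=
  ⟨f '' S.1, by
    obtain ⟨S, k, x, hx, rfl⟩ := S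
    refine ⟨k, f x, ?_, ?_⟩
    · rw [← hf.image_diff k]; exact mem_image_of_mem f hx
    · rw [← hf.image_diff k]; exact f.image_connectedComponentIn hx⟩

/-- The restriction `Q° → Q'°` of a stratified homeomorphism. -/
def IsStratifiedHomeo.restrictTop {Q : Type u} {Q' : Type v} [TopologicalSpace Q]
    [TopologicalSpace Q'] {F : ℤ → Set Q} {F' : ℤ → Set Q'} {f : Q ≃ₜ Q'}
    (hf : IsStratifiedHomeo F F' f) (N : ℤ) : C(topPart N F, topPart N F') where
  toFun x := ⟨f x, by
    have h := mem_image_of_mem f x.2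
    exact (hf.image_diff N).subset h⟩
  continuous_toFun := by fun_prop

/-- The stratified homeomorphism `f` and the automorphism `ψ` of `T^m` form a weak isomorphism
`(Q, λ, c) → (Q', λ', c')`: `c = (f|_{Q°})^* c'`, and `ψ(λ(S)) = λ'(S(f)(S))` for every
stratum `S`. -/
def CharData.IsIso {m : ℕ} {N : ℤ} {Q : Type u} {Q' : Type v} [TopologicalSpace Q]
    [TopologicalSpace Q'] (D : CharData m N Q) (D' : CharData m N Q') (f : Q ≃ₜ Q')
    (ψ : Torus m ≃ₜ* Torus m) : Prop :=
  ∃ hf : IsStratifiedHomeo D.skel D'.skel f,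
    D.chern = SingularH2.pullback (hf.restrictTop N) (Fin m → ℤ) D'.chern ∧
    ∀ S : Strata D.skel,
      (D.char (OrderDual.toDual S)).map (ψ : Torus m →* Torus m)
        = D'.char (OrderDual.toDual (hf.mapStrata S))

/-- Weakly isomorphic data. -/
def CharData.WeaklyIsomorphic {m : ℕ} {N : ℤ} {Q : Type u} {Q' : Type v} [TopologicalSpace Q]
    [TopologicalSpace Q'] (D : CharData m N Q) (D' : CharData m N Q') : Prop :=
  ∃ (f : Q ≃ₜ Q') (ψ : Torus m ≃ₜ* Torus m), D.IsIso D' f ψ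

/-- Isomorphic data: the automorphism of `T^m` is the identity. -/
def CharData.Isomorphic {m : ℕ} {N : ℤ} {Q : Type u} {Q' : Type v} [TopologicalSpace Q]
    [TopologicalSpace Q'] (D : CharData m N Q) (D' : CharData m N Q') : Prop :=
  ∃ f : Q ≃ₜ Q', D.IsIso D' f (ContinuousMulEquiv.refl (Torus m))

/-! ### Equivariant homeomorphisms -/

/-- There is a `T^m`-equivariant homeomorphism `X → X'`. -/
def EquivariantlyHomeomorphic (m : ℕ) (X : Type u) (X' : Type v) [TopologicalSpace X]
    [TopologicalSpace X'] [MulAction (Torus m) X] [MulAction (Torus m) X'] : Prop :=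
  ∃ h : X ≃ₜ X', ∀ (t : Torus m) (x : X), h (t • x) = t • h x

/-- There is a weakly `T^m`-equivariant homeomorphism `X → X'`, i.e. one that is equivariant up
to an automorphism of `T^m`. -/
def WeaklyEquivariantlyHomeomorphic (m : ℕ) (X : Type u) (X' : Type v) [TopologicalSpace X]
    [TopologicalSpace X'] [MulAction (Torus m) X] [MulAction (Torus m) X'] : Prop :=
  ∃ (h : X ≃ₜ X') (ψ : Torus m ≃ₜ* Torus m), ∀ (t : Torus m) (x : X), h (t • x) = ψ t • h x

end CharacteristicData

/-!
The key fact is that the orbit map `X → Q` of a locally standard pseudomanifold over a graph has a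
global continuous section (`exists_continuous_section`).  Sections exist locally: near a vertex
`X` is `T^{m-1}` times an open cone on circles, and base points on the circles give a section
(`exists_chart_of_mem_singularPart`); near a free orbit `X` is `Ω × T^{m-1}` with `Ω ⊆ ℂ ∖ 0`
rotation invariant, so `Q` is an open subset of the line there, over which the positive reals in
`Ω` give a section (`exists_chart_of_notMem_singularPart`).  Two sections over a subset of the line
differ by a torus valued function.  Such a function, defined near a closed subset of the line,
lifts to `ℝ^m` and hence extends from that subset to the line by Tietze's theorem
(`exists_continuous_torus_extension`).  Therefore a section near the finitely many vertices can be
continued across one chart after another (`exists_nhds_hasSectionOn_union`), and by compactness to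
all of `Q`.

The section trivializes the bundle of free orbits, so its Chern class is zero
(`isFreeChernClass_zero`).  It also presents `X` as the quotient of `T × Q` by the isotropy groups
along the section.  These are trivial off the vertices and given by the characteristic functor at
the vertices (`smul_eq_self_iff_of_isIso`), so that a homeomorphism `f` of orbit spaces and an
automorphism `ψ` of `T` that match the characteristic data are covered by the homeomorphism
`t • s q ↦ ψ t • s' (f q)` (`exists_homeomorph_of_section`).  Conversely, a weakly equivariant
homeomorphism induces such an `f`, because skeleta and isotropy groups are defined by the action
(`exists_isIso_of_homeomorph`).  Both equivalences are thus instances of one statement for a fixed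
`ψ` (`exists_isIso_iff_exists_homeomorph`).
-/

/-! ### Lifting and extending maps from subsets of the line to a torus -/

/-- The components of an open subset of the line are intervals, hence simply connected, and over
each of them the map lifts through the covering `exp`. -/
theorem exists_continuousOn_circleExp_lift {M : Set ℝ} (hM : IsOpen M) {g : ℝ → Circle}
    (hg : ContinuousOn g M) :
    ∃ θ : ℝ → ℝ, ContinuousOn θ M ∧ ∀ x ∈ M, Circle.exp (θ x) = g x := by
  classical
  have key : ∀ S : Set ℝ, ∃ θ : ℝ → ℝ, ∀ x ∈ M, S = connectedComponentIn M x →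
      ContinuousOn θ S ∧ ∀ y ∈ S, Circle.exp (θ y) = g y := by
    intro S
    by_cases hS : ∃ x ∈ M, S = connectedComponentIn M x
    swap
    · exact ⟨0, fun x hx h => absurd ⟨x, hx, h⟩ hS⟩
    obtain ⟨x, hx, rfl⟩ := hS
    set S := connectedComponentIn M x with hSdef
    have hxS : x ∈ S := mem_connectedComponentIn hx
    have hSM : S ⊆ M := connectedComponentIn_subset M x
    have hSc : Convex ℝ S := isPreconnected_connectedComponentIn.ordConnected.convex
    have hSo : IsOpen S := hM.connectedComponentIn
    have : ContractibleSpace S := hSc.contractibleSpace ⟨x, hxS⟩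
    have := hSo.locallyPathConnectedSpace
    obtain ⟨θ₀, hθ₀⟩ := Circle.exp_surjective (g x)
    obtain ⟨F, ⟨-, hF⟩, -⟩ := Circle.isCoveringMap_exp.existsUnique_continuousMap_lifts
      ⟨S.domRestrict g, continuousOn_iff_continuous_domRestrict.mp (hg.mono hSM)⟩
      (⟨x, hxS⟩ : S) θ₀ hθ₀
    refine ⟨fun y => if h : y ∈ S then F ⟨y, h⟩ else 0, fun _ _ _ => ⟨?_, ?_⟩⟩
    · rw [continuousOn_iff_continuous_domRestrict]
      convert! F.continuous
      ext y
      simp [y.2]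
    · intro y hy
      simpa [hy] using congrFun hF ⟨y, hy⟩
  choose Θ hΘ using key
  refine ⟨fun x => Θ (connectedComponentIn M x) x, ?_, ?_⟩
  · intro x hx
    have h1 := (hΘ _ x hx rfl).1 x (mem_connectedComponentIn hx)
    have hmem : connectedComponentIn M x ∈ 𝓝 x :=
      hM.connectedComponentIn.mem_nhds (mem_connectedComponentIn hx)
    refine ContinuousAt.continuousWithinAt ?_
    refine (h1.continuousAt hmem).congr ?_
    filter_upwards [hmem] with y hy
    rw [connectedComponentIn_eq hy]
  · intro x hx
    exact (hΘ _ x hx rfl).2 x (mem_connectedComponentIn hx)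

theorem exists_continuous_circle_extension {M C : Set ℝ} (hM : IsOpen M) (hC : IsClosed C)
    (hCM : C ⊆ M) {g : ℝ → Circle} (hg : ContinuousOn g M) :
    ∃ k : ℝ → Circle, Continuous k ∧ ∀ x ∈ C, k x = g x := by
  obtain ⟨θ, hθ, hexp⟩ := exists_continuousOn_circleExp_lift hM hg
  obtain ⟨Θ, hΘ⟩ := ContinuousMap.exists_restrict_eq hC
    ⟨C.domRestrict θ, continuousOn_iff_continuous_domRestrict.mp (hθ.mono hCM)⟩
  refine ⟨fun x => Circle.exp (Θ x), Circle.exp.continuous.comp Θ.continuous, fun x hx => ?_⟩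
  rw [← hexp x (hCM hx)]
  exact congrArg Circle.exp (DFunLike.congr_fun hΘ ⟨x, hx⟩)

/-- A torus valued function that is continuous near a closed subset of the line extends
continuously from that subset to the line, since it lifts to `ℝ^m`. -/
theorem exists_continuous_torus_extension {m : ℕ} {M C : Set ℝ} (hM : IsOpen M) (hC : IsClosed C)
    (hCM : C ⊆ M) {g : ℝ → Torus m} (hg : ContinuousOn g M) :
    ∃ k : ℝ → Torus m, Continuous k ∧ ∀ x ∈ C, k x = g x := by
  have h := fun j : Fin m => exists_continuous_circle_extension hM hC hCM
    (g := fun x => g x j) (continuousOn_pi.mp hg j)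
  choose k hk hkg using h
  exact ⟨fun x j => k j x, continuous_pi hk, fun x hx => funext fun j => hkg j x hx⟩

/-! ### Group actions and orbit spaces -/

theorem continuous_of_isClosed_graph {Y K : Type*} [TopologicalSpace Y] [TopologicalSpace K]
    [CompactSpace K] {f : Y → K} (h : IsClosed {p : Y × K | p.2 = f p.1}) : Continuous f := by
  refine continuous_iff_isClosed.mpr fun C hC => ?_
  have h1 := isClosedMap_fst_of_compactSpace (X := Y) (Y := K) _
    (h.inter (hC.preimage continuous_snd))
  convert h1
  ext y
  simp

/-- Two continuous maps into the free part of a Hausdorff space with an action of a compact group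
that agree up to the group differ by a continuous function. -/
theorem continuousOn_of_smul_eq {G X Y : Type*} [TopologicalSpace G] [CompactSpace G] [Group G]
    [TopologicalSpace X] [T2Space X] [MulAction G X] [ContinuousSMul G X] [TopologicalSpace Y]
    {M : Set Y} {a b : Y → X} {g : Y → G} (ha : ContinuousOn a M) (hb : ContinuousOn b M)
    (hg : ∀ y ∈ M, g y • b y = a y) (hfree : ∀ y ∈ M, ∀ t : G, t • b y = b y → t = 1) :
    ContinuousOn g M := by
  rw [continuousOn_iff_continuous_domRestrict] at *
  refine continuous_of_isClosed_graph ?_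
  have h : {p : M × G | p.2 = M.domRestrict g p.1} =
      {p : M × G | p.2 • M.domRestrict b p.1 = M.domRestrict a p.1} := by
    ext ⟨y, t⟩
    simp only [mem_ofPred_eq, domRestrict_apply]
    rw [← hg y y.2]
    refine ⟨fun h => by rw [h], fun h => ?_⟩
    have := hfree y y.2 ((g y)⁻¹ * t) (by rw [mul_smul, h, inv_smul_smul])
    exact (inv_mul_eq_one.mp this).symm
  rw [h]
  exact isClosed_eq (continuous_snd.smul (hb.comp continuous_fst)) (ha.comp continuous_fst)

theorem isOpenQuotientMap_orbitProj (m : ℕ) (X : Type*) [TopologicalSpace X]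
    [MulAction (Torus m) X] [ContinuousSMul (Torus m) X] :
    IsOpenQuotientMap (orbitProj m : X → OrbitSpace m X) :=
  MulAction.isOpenQuotientMap_quotientMk

theorem orbitProj_eq_iff {m : ℕ} {X : Type*} [MulAction (Torus m) X] {x y : X} :
    orbitProj m x = orbitProj m y ↔ ∃ t : Torus m, t • y = x := by
  unfold orbitProj
  rw [Quotient.eq]
  exact MulAction.orbitRel_apply

theorem orbitProj_smul {m : ℕ} {X : Type*} [MulAction (Torus m) X] (t : Torus m) (x : X) :
    orbitProj m (t • x) = orbitProj m x :=
  orbitProj_eq_iff.mpr ⟨t, rfl⟩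

theorem t2Space_orbitSpace (m : ℕ) (X : Type*) [TopologicalSpace X] [T2Space X]
    [MulAction (Torus m) X] [ContinuousSMul (Torus m) X] : T2Space (OrbitSpace m X) := by
  refine (t2Space_iff_of_isOpenQuotientMap (isOpenQuotientMap_orbitProj m X)).mpr ?_
  have h := isClosedMap_snd_of_compactSpace (X := Torus m) (Y := X × X)
    {p | p.1 • p.2.2 = p.2.1} (isClosed_eq (by fun_prop) (by fun_prop))
  convert h
  ext ⟨x, y⟩
  simp [orbitProj_eq_iff]

/-- An invariant function that is continuous on an invariant open set descends to the orbit
space. -/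
theorem exists_descend_orbitSpace {m : ℕ} {X Z : Type*} [TopologicalSpace X] [TopologicalSpace Z]
    [MulAction (Torus m) X] [ContinuousSMul (Torus m) X] {U : Set X} (hU : IsOpen U)
    {F : X → Z} (hF : ContinuousOn F U) (hFT : ∀ (t : Torus m), ∀ y ∈ U, F (t • y) = F y) :
    ∃ f : OrbitSpace m X → Z, ContinuousOn f (orbitProj m '' U) ∧
      ∀ y ∈ U, f (orbitProj m y) = F y := by
  have hval : ∀ y ∈ U, F (Quotient.out (orbitProj m y)) = F y := by
    intro y hy
    obtain ⟨t, ht⟩ := orbitProj_eq_iff.mp (Quotient.out_eq (orbitProj m y))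
    rw [← ht, hFT t y hy]
  refine ⟨fun q => F (Quotient.out q), ?_, hval⟩
  rintro _ ⟨y, hy, rfl⟩
  have hπ := isOpenQuotientMap_orbitProj m X
  refine ContinuousAt.continuousWithinAt ?_
  rw [ContinuousAt, ← hπ.isOpenMap.map_nhds_eq hπ.continuous.continuousAt, Filter.tendsto_map'_iff,
    hval y hy]
  refine (hF.continuousAt (hU.mem_nhds hy)).tendsto.congr' ?_
  filter_upwards [hU.mem_nhds hy] with z hz
  exact (hval z hz).symm

/-! ### Open cones -/

theorem OpenCone.continuous_map {L : Type*} [TopologicalSpace L] {f : L → L}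
    (hf : Continuous f) : Continuous (OpenCone.map f) :=
  Continuous.quotient_map' (s := coneSetoid L) (t := coneSetoid L) (by fun_prop) _

theorem OpenCone.map_mk {L : Type*} (f : L → L) (x : L) (s : Ico (0 : ℝ) 1) :
    OpenCone.map f (OpenCone.mk x s) = OpenCone.mk (f x) s := rfl

theorem OpenCone.map_vertex {L : Type*} (f : L → L) :
    OpenCone.map f (OpenCone.vertex L) = OpenCone.vertex L := rfl

theorem OpenCone.eq_vertex_or_eq_mk {L : Type*} (z : OpenCone L) :
    z = OpenCone.vertex L ∨ ∃ x s, 0 < s.1 ∧ z = OpenCone.mk x s := by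
  obtain ⟨_ | ⟨x, s⟩⟩ := z
  · exact Or.inl rfl
  · rcases s.2.1.eq_or_lt with h | h
    · exact Or.inl (Quotient.sound (s := coneSetoid L) (Or.inr ⟨h.symm, rfl⟩))
    · exact Or.inr ⟨x, s, h, rfl⟩

theorem OpenCone.eq_of_mk_eq_mk {L : Type*} {x y : L} {s : Ico (0 : ℝ) 1} (hs : 0 < s.1)
    (h : OpenCone.mk x s = OpenCone.mk y s) : x = y := by
  rcases Quotient.exact (s := coneSetoid L) h with h | h
  · exact congrArg Prod.fst (Sum.inr_injective h)
  · exact absurd h.1 hs.ne'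

/-! ### Charts of a locally standard pseudomanifold over a graph -/

theorem continuousOn_extend_subtypeVal {Y Z : Type*} [TopologicalSpace Y] [TopologicalSpace Z]
    {U : Set Y} {f : U → Z} (hf : Continuous f) (g : Y → Z) :
    ContinuousOn (Function.extend Subtype.val f g) U := by
  rw [continuousOn_iff_continuous_domRestrict]
  convert! hf using 1
  ext y
  exact Subtype.val_injective.extend_apply f g y

theorem exists_circle_mul_norm (w : ℂ) : ∃ u : Circle, (u : ℂ) * (‖w‖ : ℂ) = w :=
  ⟨Circle.exp w.arg, by rw [Circle.coe_exp, mul_comm, Complex.norm_mul_exp_arg_mul_I]⟩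

/-- The points with nontrivial isotropy group, i.e. the preimage of the vertices of the graph. -/
def singularPart (m : ℕ) (X : Type*) [MulAction (Torus m) X] : Set X :=
  orbitSkel 0 1 m X (m - 1)

theorem exists_smul_eq_of_mem_singularPart {m : ℕ} {X : Type*}
    [MulAction (Torus m) X] {x : X} (hx : x ∈ singularPart m X) :
    ∃ t : Torus m, t • x = x ∧ t ≠ 1 := by
  obtain ⟨i, hi, r, ⟨e⟩, hr⟩ := hx
  have hr1 : 0 < r := by
    push_cast at hi hr
    omega
  obtain ⟨z, hz⟩ : ∃ z : Torus r, z ≠ 1 :=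
    ⟨fun _ => Circle.exp Real.pi, fun h => by
      have := congrArg Subtype.val (congrFun h ⟨0, hr1⟩)
      norm_num at this⟩
  refine ⟨e.symm z, (e.symm z).2, fun h => hz ?_⟩
  have : e.symm z = 1 := Subtype.ext h
  rw [← e.apply_symm_apply z, this, map_one]

section Charts

universe u

variable {m : ℕ} {X : Type u} [TopologicalSpace X] [MulAction (Torus m) X]

theorem one_le_of_isLocallyStandard (hX : IsLocallyStandard 0 1 m X) : 1 ≤ m := by
  rw [IsLocallyStandard] at hX
  exact hX.2.2.2.2.2.2.1

theorem isClosed_singularPart (hX : IsLocallyStandard 0 1 m X) :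
    IsClosed (singularPart m X) := by
  rw [IsLocallyStandard] at hX
  have h := hX.2.2.2.2.2.2.2.1
  rw [IsTopStratPseudomanifold] at h
  exact h.1.2.2.2.1 _

theorem nonempty_of_isLocallyStandard (hX : IsLocallyStandard 0 1 m X) : Nonempty X := by
  rw [IsLocallyStandard] at hX
  have h := hX.2.2.2.2.2.2.2.1
  rw [IsTopStratPseudomanifold] at h
  exact h.1.2.1

theorem orbitSkel_eq_univ (hX : IsLocallyStandard 0 1 m X) {k : ℤ} (hk : (m : ℤ) + 1 ≤ k) :
    orbitSkel 0 1 m X k = univ := by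
  have hm := one_le_of_isLocallyStandard hX
  rw [IsLocallyStandard] at hX
  have h := hX.2.2.2.2.2.2.2.1
  rw [IsTopStratPseudomanifold] at h
  have h1 := h.1.2.2.2.2.2.2.1
  refine univ_subset_iff.mp (h1 ▸ h.1.2.2.1 ?_)
  push_cast [Nat.cast_sub hm]
  linarith

theorem orbitSkel_eq_empty (hX : IsLocallyStandard 0 1 m X) {k : ℤ} (hk : k < (m : ℤ) - 1) :
    orbitSkel 0 1 m X k = ∅ := by
  have hm := one_le_of_isLocallyStandard hX
  rw [IsLocallyStandard] at hX
  have h := hX.2.2.2.2.2.2.2.1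
  rw [IsTopStratPseudomanifold] at h
  exact h.1.2.2.2.2.1 _ (by push_cast [Nat.cast_sub hm]; linarith)

/-- Near a free orbit the pseudomanifold is `Ω × T^{m-1}` with `Ω ⊆ ℂ ∖ 0` open and rotation
invariant.  The modulus `ρ` on `Ω` is a coordinate on the orbit space, with values in an open
subset `W` of the line, and the positive reals in `Ω` provide a section `σ` over `W`. -/
theorem exists_chart_of_notMem_singularPart [ContinuousSMul (Torus m) X]
    (hX : IsLocallyStandard 0 1 m X) {x : X} (hx : x ∉ singularPart m X) :
    ∃ (U : Set X) (W : Set ℝ) (ρ : X → ℝ) (σ : ℝ → X),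
      IsOpen U ∧ x ∈ U ∧ IsOpen W ∧ ContinuousOn ρ U ∧ ContinuousOn σ W ∧
      (∀ y ∈ U, ρ y ∈ W ∧ (∀ t : Torus m, ρ (t • y) = ρ y) ∧ ∃ t : Torus m, t • σ (ρ y) = y) ∧
      (∀ w ∈ W, σ w ∈ U ∧ ρ (σ w) = w) ∧
      ∀ y ∈ U, ∀ t : Torus m, t • y = y → t = 1 := by
  have huniv := orbitSkel_eq_univ hX (k := (0 : ℕ) + 2 * ((1 : ℕ) : ℤ) + (m - (1 : ℕ)))
    (by push_cast; linarith)
  rw [IsLocallyStandard] at hX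
  obtain ⟨-, -, -, -, -, -, -, -, -, -, h⟩ := hX
  rw [if_neg (by norm_num)] at h
  obtain ⟨U, L, _, _, O, Ω, α, φ, hU, hxU, hUT, hL, -, -, hΩ, hΩ0, hΩT, -, hφ⟩ :=
    h 1 le_rfl x ⟨by rw [huniv]; trivial, by simpa [singularPart] using hx⟩
  have hLe : IsEmpty L := by
    rcases hL with ⟨-, h⟩ | ⟨l', n', h, -⟩
    · exact h
    · omega
  have hcone : ∀ z : OpenCone L, z = OpenCone.vertex L := by
    rintro ⟨_ | p⟩
    · rfl
    · exact isEmptyElim p.1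
  let W : Set ℝ := {r | 0 < r ∧ (fun _ => (r : ℂ)) ∈ Ω}
  let ρ₀ : U → ℝ := fun y => ‖((φ y).2.1.1 : Fin 1 → ℂ) 0‖
  let σ₀ : W → X := fun r =>
    φ.symm ((φ ⟨x, hxU⟩).1, (⟨fun _ => ((r : ℝ) : ℂ), r.2.2⟩, 1), OpenCone.vertex L)
  have hρ₀c : Continuous ρ₀ :=
    ((continuous_apply 0).comp (continuous_subtype_val.comp
      (φ.continuous.snd.fst.fst))).norm
  have hσ₀c : Continuous σ₀ :=
    continuous_subtype_val.comp (φ.symm.continuous.comp (by fun_prop))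
  have hρ : ∀ y (hy : y ∈ U), Function.extend Subtype.val ρ₀ 0 y = ρ₀ ⟨y, hy⟩ :=
    fun y hy => Subtype.val_injective.extend_apply ρ₀ 0 ⟨y, hy⟩
  have hσ : ∀ r (hr : r ∈ W), Function.extend Subtype.val σ₀ (fun _ => x) r = σ₀ ⟨r, hr⟩ :=
    fun r hr => Subtype.val_injective.extend_apply σ₀ _ ⟨r, hr⟩
  have hφ' : ∀ (t : Torus m) (y : U), _ := fun t y => hφ t y ⟨t • y, hUT t y y.2⟩ rfl
  have hW : ∀ y : U, ρ₀ y ∈ W := by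
    intro y
    have hw := (φ y).2.1.1.2
    obtain ⟨u, hu⟩ := exists_circle_mul_norm (((φ y).2.1.1 : Fin 1 → ℂ) 0)
    refine ⟨norm_pos_iff.mpr (hΩ0 _ hw 0), ?_⟩
    convert hΩT (fun _ => u⁻¹) _ hw using 1
    funext j
    rw [Subsingleton.elim j 0, ← hu]
    simp [ρ₀]
  refine ⟨U, W, Function.extend Subtype.val ρ₀ 0, Function.extend Subtype.val σ₀ (fun _ => x),
    hU, hxU, ?_, continuousOn_extend_subtypeVal hρ₀c _, continuousOn_extend_subtypeVal hσ₀c _,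
    fun y hy => ⟨?_, fun t => ?_, ?_⟩, fun w hw => ⟨?_, ?_⟩, fun y hy t ht => ?_⟩
  · exact (isOpen_lt continuous_const continuous_id).inter (hΩ.preimage (by fun_prop))
  · rw [hρ y hy]
    exact hW _
  · rw [hρ y hy, hρ _ (hUT t y hy)]
    have := (hφ' t ⟨y, hy⟩).2.1 0
    simp only [ρ₀]
    rw [this, norm_mul, Circle.norm_coe, one_mul]
  · rw [hρ y hy, hσ _ (hW _)]
    obtain ⟨u, hu⟩ := exists_circle_mul_norm (((φ ⟨y, hy⟩).2.1.1 : Fin 1 → ℂ) 0)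
    refine ⟨α.symm ((fun _ => u, (φ ⟨y, hy⟩).2.1.2), 1), ?_⟩
    have h := hφ' (α.symm ((fun _ => u, (φ ⟨y, hy⟩).2.1.2), 1))
      (φ.symm ((φ ⟨x, hxU⟩).1, (⟨fun _ => ((ρ₀ ⟨y, hy⟩ : ℝ) : ℂ), (hW _).2⟩, 1),
        OpenCone.vertex L))
    simp only [Homeomorph.apply_symm_apply, ContinuousMulEquiv.apply_symm_apply] at h
    refine congrArg Subtype.val (φ.injective (a₁ := ⟨_, hUT _ _ (Subtype.coe_prop _)⟩)
      (a₂ := ⟨y, hy⟩) ?_)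
    refine Prod.ext (Subsingleton.elim _ _) (Prod.ext (Prod.ext (Subtype.ext ?_) ?_) ?_)
    · funext j
      rw [Subsingleton.elim j 0]
      exact (h.2.1 0).trans hu
    · exact h.2.2.1.trans (mul_one _)
    · rw [hcone (φ _).2.2, hcone (φ ⟨y, hy⟩).2.2]
  · rw [hσ w hw]
    exact Subtype.coe_prop _
  · rw [hσ w hw, hρ _ (Subtype.coe_prop _)]
    simp [ρ₀, abs_of_pos hw.1]
  · have h := hφ t ⟨y, hy⟩ ⟨y, hy⟩ ht.symm
    have hy0 := hΩ0 _ (φ ⟨y, hy⟩).2.1.1.2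
    refine α.injective ?_
    rw [map_one]
    refine Prod.ext (Prod.ext (funext fun j => ?_) ?_) (funext fun j => j.elim0)
    · have h1 := h.2.1 j
      exact Circle.ext ((mul_eq_right₀ (hy0 j)).mp h1.symm)
    · exact (mul_eq_right.mp h.2.2.1.symm)

/-- Near a singular orbit the pseudomanifold is `T^{m-1}` times the open cone on finitely many
circles, and the retraction of the circles to base points induces a section of the orbit map.  The
section is described here as the invariant map `τ`. -/
theorem exists_chart_of_mem_singularPart [ContinuousSMul (Torus m) X]
    (hX : IsLocallyStandard 0 1 m X) {x : X} (hx : x ∈ singularPart m X) :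
    ∃ (U : Set X) (τ : X → X), IsOpen U ∧ x ∈ U ∧ ContinuousOn τ U ∧
      (∀ y ∈ U, (∀ t : Torus m, τ (t • y) = τ y) ∧ ∃ t : Torus m, t • τ y = y) ∧
      ∀ y ∈ U, (∃ t : Torus m, t • y = y ∧ t ≠ 1) → ∃ t : Torus m, t • x = y := by
  have hempty := orbitSkel_eq_empty hX (k := (0 : ℕ) + 2 * (((0 : ℕ) : ℤ) - 1) + (m - (1 : ℕ)))
    (by push_cast; linarith)
  rw [IsLocallyStandard] at hX
  obtain ⟨-, -, -, -, -, -, -, -, -, -, h⟩ := hX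
  rw [if_neg (by norm_num)] at h
  obtain ⟨U, L, _, _, O, Ω, α, φ, hU, hxU, hUT, hL, -, -, -, -, -, -, hφ⟩ :=
    h 0 zero_le_one x ⟨by simpa [singularPart] using hx, by rw [hempty]; exact notMem_empty x⟩
  have hLs : ∃ (r : ℕ) (e : L ≃ₜ Fin r × Torus 1),
      ∀ (t : Torus 1) (x : L), e (t • x) = ((e x).1, t * (e x).2) := by
    rcases hL with ⟨h, -⟩ | ⟨l', n', h, hL⟩
    · omega
    · rw [IsLocallyStandard, if_pos (by omega)] at hL
      exact hL.2.2.2.2.2.2.2.2.2.2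
  obtain ⟨r, e, he⟩ := hLs
  let κ : L → L := fun z => e.symm ((e z).1, 1)
  have hκ : Continuous κ := by fun_prop
  have hκs : ∀ (t : Torus 1) z, κ (t • z) = κ z := fun t z => by simp [κ, he]
  have hκo : ∀ z, (e z).2 • κ z = z := fun z => by
    refine e.injective ?_
    rw [he]
    simp [κ]
  have hLfree : ∀ (t : Torus 1) (z : L), t • z = z → t = 1 := fun t z h => by
    have h1 := congrArg (fun z => (e z).2) h
    simp only [he] at h1
    exact mul_eq_right.mp h1
  let τ₀ : U → X := fun y =>
    φ.symm ((φ y).1, ((φ y).2.1.1, 1), OpenCone.map κ (φ y).2.2)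
  have hτ₀c : Continuous τ₀ := by
    have h := (OpenCone.continuous_map hκ).comp φ.continuous.snd.snd
    exact continuous_subtype_val.comp (φ.symm.continuous.comp
      (φ.continuous.fst.prodMk ((φ.continuous.snd.fst.fst.prodMk continuous_const).prodMk h)))
  have hτ : ∀ y (hy : y ∈ U), Function.extend Subtype.val τ₀ id y = τ₀ ⟨y, hy⟩ :=
    fun y hy => Subtype.val_injective.extend_apply τ₀ id ⟨y, hy⟩
  have hφ' : ∀ (t : Torus m) (y : U), _ := fun t y => hφ t y ⟨t • y, hUT t y y.2⟩ rfl
  -- A point of the chart with a nontrivial isotropy element lies over the vertex of the cone.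
  have hvert : ∀ y : U, (∃ t : Torus m, t • (y : X) = y ∧ t ≠ 1) →
      (φ y).2.2 = OpenCone.vertex L := by
    rintro y ⟨t, ht, ht1⟩
    have h := hφ t y y ht.symm
    rcases OpenCone.eq_vertex_or_eq_mk (φ y).2.2 with hz | ⟨b, s, hs, hz⟩
    · exact hz
    · refine absurd (α.injective ?_) ht1
      rw [map_one]
      refine Prod.ext (Prod.ext (funext fun j => j.elim0) ?_) ?_
      · exact (mul_eq_right.mp h.2.2.1.symm)
      · have h1 := h.2.2.2
        rw [hz, OpenCone.map_mk] at h1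
        exact hLfree _ b (OpenCone.eq_of_mk_eq_mk hs h1).symm
  have horbit : ∀ (y y' : U) (t : Torus m), (φ y').2.1.2 = (α t).1.2 * (φ y).2.1.2 →
      (φ y').2.2 = OpenCone.map (fun z : L => (α t).2 • z) (φ y).2.2 → t • (y : X) = y' := by
    intro y y' t h1 h2
    refine congrArg Subtype.val (φ.injective (a₁ := ⟨t • (y : X), hUT t y y.2⟩) ?_)
    have h := hφ' t y
    exact Prod.ext (Subsingleton.elim _ _) (Prod.ext (Prod.ext (Subsingleton.elim _ _)
      (h.2.2.1.trans h1.symm)) (h.2.2.2.trans h2.symm))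
  refine ⟨U, Function.extend Subtype.val τ₀ id, hU, hxU, continuousOn_extend_subtypeVal hτ₀c _,
    fun y hy => ⟨fun t => ?_, ?_⟩, fun y hy ht => ?_⟩
  · rw [hτ y hy, hτ _ (hUT t y hy)]
    have h := hφ' t ⟨y, hy⟩
    refine congrArg (fun z => (φ.symm z : X)) (Prod.ext h.1 (Prod.ext (Prod.ext
      (Subsingleton.elim _ _) rfl) ?_))
    simp only [h.2.2.2]
    rcases OpenCone.eq_vertex_or_eq_mk (φ ⟨y, hy⟩).2.2 with hz | ⟨b, s, -, hz⟩
    · rw [hz]; rfl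
    · rw [hz, OpenCone.map_mk, OpenCone.map_mk, OpenCone.map_mk]
      exact congrArg (OpenCone.mk · s) (hκs _ b)
  · rw [hτ y hy]
    rcases OpenCone.eq_vertex_or_eq_mk (φ ⟨y, hy⟩).2.2 with hz | ⟨b, s, -, hz⟩
    · refine ⟨α.symm ((1, (φ ⟨y, hy⟩).2.1.2), 1), horbit _ ⟨y, hy⟩ _ ?_ ?_⟩
      · simp
      · simp [hz, OpenCone.map_vertex]
    · refine ⟨α.symm ((1, (φ ⟨y, hy⟩).2.1.2), (e b).2), horbit _ ⟨y, hy⟩ _ ?_ ?_⟩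
      · simp
      · simp only [Homeomorph.apply_symm_apply, ContinuousMulEquiv.apply_symm_apply, hz,
          OpenCone.map_mk]
        exact congrArg (OpenCone.mk · s) (hκo b).symm
  · refine ⟨α.symm ((1, (φ ⟨y, hy⟩).2.1.2 * ((φ ⟨x, hxU⟩).2.1.2)⁻¹), 1),
      horbit ⟨x, hxU⟩ ⟨y, hy⟩ _ ?_ ?_⟩
    · simp
    · rw [hvert ⟨y, hy⟩ ht, hvert ⟨x, hxU⟩ (exists_smul_eq_of_mem_singularPart hx)]
      rfl

theorem exists_smul_eq_iff_mem_singularPart [ContinuousSMul (Torus m) X]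
    (hX : IsLocallyStandard 0 1 m X) {x : X} :
    (∃ t : Torus m, t • x = x ∧ t ≠ 1) ↔ x ∈ singularPart m X := by
  refine ⟨fun ⟨t, ht, ht1⟩ => ?_, exists_smul_eq_of_mem_singularPart⟩
  by_contra hx
  obtain ⟨U, W, ρ, σ, -, hxU, -, -, -, -, -, h⟩ := exists_chart_of_notMem_singularPart hX hx
  exact ht1 (h x hxU t ht)

end Charts

/-! ### Sections of the orbit map -/

section Sections

universe u

/-- The orbit map has a continuous section over `N`.  Values outside `N` are irrelevant. -/
def HasSectionOn (m : ℕ) (X : Type*) [TopologicalSpace X] [MulAction (Torus m) X]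
    (N : Set (OrbitSpace m X)) : Prop :=
  ∃ s : OrbitSpace m X → X, ContinuousOn s N ∧ ∀ q ∈ N, orbitProj m (s q) = q

variable {m : ℕ} {X : Type u} [TopologicalSpace X] [MulAction (Torus m) X]
  [ContinuousSMul (Torus m) X]

/-- Near a free orbit any section can be extended, after shrinking its domain: in a chart it
differs from the section of the chart by a torus valued function on a subset of the line, which
extends to the line. -/
theorem exists_nhds_hasSectionOn_union [T2Space X]
    [NormalSpace (OrbitSpace m X)] [RegularSpace (OrbitSpace m X)] (hX : IsLocallyStandard 0 1 m X)
    {x : X} (hx : x ∉ singularPart m X) :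
    ∃ t ∈ 𝓝 (orbitProj m x), ∀ K N : Set (OrbitSpace m X), IsClosed K → IsOpen N → K ⊆ N →
      HasSectionOn m X N → ∃ N', IsOpen N' ∧ K ∪ closure t ⊆ N' ∧ HasSectionOn m X N' := by
  classical
  obtain ⟨U, W, ρ, σ, hU, hxU, hW, hρ, hσ, hUρ, hWσ, hfree⟩ :=
    exists_chart_of_notMem_singularPart hX hx
  have hπ := isOpenQuotientMap_orbitProj m X
  obtain ⟨r, hr, hrρ⟩ := exists_descend_orbitSpace hU hρ (fun t y hy => (hUρ y hy).2.1 t)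
  have hB : IsOpen (orbitProj m '' U) := hπ.isOpenMap U hU
  obtain ⟨ε, hε, hball⟩ := Metric.nhds_basis_closedBall.mem_iff.mp (hW.mem_nhds (hUρ x hxU).1)
  set B' := orbitProj m '' U ∩ r ⁻¹' Metric.ball (ρ x) ε with hB'def
  have hB' : IsOpen B' := hr.isOpen_inter_preimage hB Metric.isOpen_ball
  have hxB' : orbitProj m x ∈ B' :=
    ⟨mem_image_of_mem _ hxU, by simpa [hrρ x hxU] using hε⟩
  have hB'J : ∀ q ∈ B', r q ∈ Metric.closedBall (ρ x) ε :=
    fun q hq => Metric.ball_subset_closedBall hq.2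
  have hB'σ : ∀ q ∈ B', orbitProj m (σ (r q)) = q := by
    rintro _ ⟨⟨y, hy, rfl⟩, -⟩
    obtain ⟨t, ht⟩ := (hUρ y hy).2.2
    rw [hrρ y hy]
    conv_rhs => rw [← ht]
    rw [orbitProj_smul]
  obtain ⟨t, ht, htc, htB'⟩ := exists_mem_nhds_isClosed_subset (hB'.mem_nhds hxB')
  refine ⟨t, ht, fun K N hK hN hKN ⟨s, hs, hsπ⟩ => ?_⟩
  obtain ⟨N₀, hN₀, hKN₀, hN₀N⟩ := normal_exists_closure_subset hK hN hKN
  have he : ContinuousOn (fun w => orbitProj m (σ w)) W := hπ.continuous.comp_continuousOn hσ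
  have hC : IsClosed (Metric.closedBall (ρ x) ε ∩ (fun w => orbitProj m (σ w)) ⁻¹' closure N₀) :=
    (he.mono hball).preimage_isClosed_of_isClosed Metric.isClosed_closedBall isClosed_closure
  have hM : IsOpen (W ∩ (fun w => orbitProj m (σ w)) ⁻¹' N) := he.isOpen_inter_preimage hW hN
  have hg : ∀ w, ∃ g : Torus m, w ∈ W ∩ (fun w => orbitProj m (σ w)) ⁻¹' N →
      g • σ w = s (orbitProj m (σ w)) := by
    intro w
    by_cases hw : w ∈ W ∩ (fun w => orbitProj m (σ w)) ⁻¹' N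
    · obtain ⟨g, hg⟩ := orbitProj_eq_iff.mp (hsπ _ hw.2)
      exact ⟨g, fun _ => hg⟩
    · exact ⟨1, fun h => absurd h hw⟩
  choose g hg using hg
  have hgc : ContinuousOn g (W ∩ (fun w => orbitProj m (σ w)) ⁻¹' N) :=
    continuousOn_of_smul_eq (hs.comp (he.mono inter_subset_left) (fun w hw => hw.2))
      (hσ.mono inter_subset_left) hg (fun w hw => hfree _ (hWσ w hw.1).1)
  obtain ⟨k, hk, hkg⟩ := exists_continuous_torus_extension hM hC
    (inter_subset_inter hball (preimage_mono hN₀N)) hgc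
  have hk' : ContinuousOn (fun q => k (r q) • σ (r q)) B' := by
    have hrB' : ContinuousOn r B' := hr.mono inter_subset_left
    exact (hk.comp_continuousOn hrB').smul (hσ.comp hrB' (fun q hq => hball (hB'J q hq)))
  have hagree : ∀ q ∈ B' ∩ N₀, k (r q) • σ (r q) = s q := by
    rintro q ⟨hq, hqN⟩
    have hq' := hB'σ q hq
    have hmem : orbitProj m (σ (r q)) ∈ closure N₀ := by rw [hq']; exact subset_closure hqN
    rw [hkg _ ⟨hB'J q hq, hmem⟩, hg _ ⟨hball (hB'J q hq), hN₀N hmem⟩, hq']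
  refine ⟨N₀ ∪ B', hN₀.union hB', ?_, fun q => if q ∈ N₀ then s q else k (r q) • σ (r q), ?_, ?_⟩
  · rw [htc.closure_eq]
    exact union_subset_union hKN₀ htB'
  · refine ContinuousOn.union_of_isOpen ?_ ?_ hN₀ hB'
    · exact (hs.mono (subset_closure.trans hN₀N)).congr (fun q hq => if_pos hq)
    · refine hk'.congr (fun q hq => ?_)
      by_cases hqN : q ∈ N₀
      · simp only [if_pos hqN, hagree q ⟨hq, hqN⟩]
      · simp only [if_neg hqN]
  · intro q hq
    by_cases hqN : q ∈ N₀
    · simp only [if_pos hqN]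
      exact hsπ q (hN₀N (subset_closure hqN))
    · simp only [if_neg hqN]
      rw [orbitProj_smul]
      exact hB'σ q (hq.resolve_left hqN)

/-- Around a vertex of the graph there is a section, and no other vertex. -/
theorem exists_nhds_hasSectionOn_vertex (hX : IsLocallyStandard 0 1 m X)
    {x : X} (hx : x ∈ singularPart m X) :
    ∃ B : Set (OrbitSpace m X), IsOpen B ∧ orbitProj m x ∈ B ∧ HasSectionOn m X B ∧
      B ∩ orbitProj m '' singularPart m X ⊆ {orbitProj m x} := by
  obtain ⟨U, τ, hU, hxU, hτ, hτT, hUx⟩ := exists_chart_of_mem_singularPart hX hx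
  have hπ := isOpenQuotientMap_orbitProj m X
  obtain ⟨s, hs, hsτ⟩ := exists_descend_orbitSpace hU hτ (fun t y hy => (hτT y hy).1 t)
  refine ⟨orbitProj m '' U, hπ.isOpenMap U hU, mem_image_of_mem _ hxU, ⟨s, hs, ?_⟩, ?_⟩
  · rintro _ ⟨y, hy, rfl⟩
    obtain ⟨t, ht⟩ := (hτT y hy).2
    rw [hsτ y hy]
    conv_rhs => rw [← ht]
    rw [orbitProj_smul]
  · rintro _ ⟨⟨y, hy, rfl⟩, z, hz, hzy⟩
    obtain ⟨a, ha⟩ := orbitProj_eq_iff.mp hzy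
    obtain ⟨t, ht, ht1⟩ := exists_smul_eq_of_mem_singularPart hz
    have hty : t • y = y := by
      rw [← ha, smul_smul, mul_comm, mul_smul] at ht
      exact MulAction.injective a ht
    obtain ⟨b, hb⟩ := hUx y hy ⟨t, hty, ht1⟩
    exact (orbitProj_eq_iff.mpr ⟨b, hb⟩)

theorem finite_image_singularPart (hX : IsLocallyStandard 0 1 m X) :
    (orbitProj m '' singularPart m X).Finite := by
  have : CompactSpace X := by
    rw [IsLocallyStandard] at hX
    exact hX.2.1
  have hπ := isOpenQuotientMap_orbitProj m X
  have hVc : IsCompact (orbitProj m '' singularPart m X) :=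
    (isClosed_singularPart hX).isCompact.image hπ.continuous
  refine hVc.induction_on (p := fun S => (S ∩ orbitProj m '' singularPart m X).Finite)
    (by simp) (fun s t hst ht => ht.subset (inter_subset_inter_left _ hst))
    (fun s t hs ht => by rw [union_inter_distrib_right]; exact hs.union ht) ?_ |>.subset
    (fun q hq => ⟨hq, hq⟩)
  rintro _ ⟨x, hx, rfl⟩
  obtain ⟨B, hB, hxB, -, hBV⟩ := exists_nhds_hasSectionOn_vertex hX hx
  exact ⟨B, mem_nhdsWithin_of_mem_nhds (hB.mem_nhds hxB), (finite_singleton _).subset hBV⟩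

theorem exists_nhds_hasSectionOn_vertices [T2Space X] (hX : IsLocallyStandard 0 1 m X) :
    ∃ N : Set (OrbitSpace m X), IsOpen N ∧ orbitProj m '' singularPart m X ⊆ N ∧
      HasSectionOn m X N := by
  classical
  have := t2Space_orbitSpace m X
  have hfin := finite_image_singularPart hX
  obtain ⟨D, hD, hdisj⟩ := hfin.t2_separation
  have h : ∀ v : orbitProj m '' singularPart m X, ∃ B : Set (OrbitSpace m X),
      IsOpen B ∧ v.1 ∈ B ∧ HasSectionOn m X B := by
    rintro ⟨_, x, hx, rfl⟩
    obtain ⟨B, hB, hxB, hs, -⟩ := exists_nhds_hasSectionOn_vertex hX hx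
    exact ⟨B, hB, hxB, hs⟩
  choose B hB hvB s hs hsπ using h
  have huniq : ∀ (v v' : orbitProj m '' singularPart m X) (q : OrbitSpace m X),
      q ∈ D v → q ∈ D v' → v = v' := by
    intro v v' q hq hq'
    by_contra hne
    exact disjoint_left.mp (hdisj v.2 v'.2 (fun h => hne (Subtype.ext h))) hq hq'
  have : Nonempty X := nonempty_of_isLocallyStandard hX
  let S : OrbitSpace m X → X := fun q =>
    if h : ∃ v : orbitProj m '' singularPart m X, q ∈ D v then s h.choose q
    else Classical.arbitrary X
  have hS : ∀ (v : orbitProj m '' singularPart m X), ∀ q ∈ D v, S q = s v q := by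
    intro v q hq
    have h : ∃ v : orbitProj m '' singularPart m X, q ∈ D v := ⟨v, hq⟩
    simp only [S, dif_pos h]
    rw [huniq _ v q h.choose_spec hq]
  refine ⟨⋃ v : orbitProj m '' singularPart m X, D v ∩ B v,
    isOpen_iUnion fun v => (hD v).2.inter (hB v),
    fun q hq => mem_iUnion.mpr ⟨⟨q, hq⟩, (hD q).1, hvB ⟨q, hq⟩⟩, S, ?_, ?_⟩
  · intro q hq
    obtain ⟨v, hv⟩ := mem_iUnion.mp hq
    refine ContinuousAt.continuousWithinAt ?_
    refine ((hs v).continuousAt ((hB v).mem_nhds hv.2)).congr ?_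
    filter_upwards [(hD v).2.mem_nhds hv.1] with q' hq'
    exact (hS v q' hq').symm
  · intro q hq
    obtain ⟨v, hv⟩ := mem_iUnion.mp hq
    rw [hS v q hv.1]
    exact hsπ v q hv.2

/-- The orbit map onto the graph has a global continuous section. -/
theorem exists_continuous_section [T2Space X] (hX : IsLocallyStandard 0 1 m X) :
    ∃ s : OrbitSpace m X → X, Continuous s ∧ ∀ q, orbitProj m (s q) = q := by
  have : CompactSpace X := by
    rw [IsLocallyStandard] at hX
    exact hX.2.1
  have hπ := isOpenQuotientMap_orbitProj m X
  have := t2Space_orbitSpace m X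
  have : CompactSpace (OrbitSpace m X) := hπ.surjective.compactSpace hπ.continuous
  obtain ⟨N, hN, hVN, hsN⟩ := exists_nhds_hasSectionOn_vertices hX
  obtain ⟨N₀, hN₀, hVN₀, hN₀N⟩ := normal_exists_closure_subset
    (finite_image_singularPart hX).isClosed hN hVN
  have hind : ∀ K N : Set (OrbitSpace m X), IsClosed K → IsOpen N → K ⊆ N →
      HasSectionOn m X N → ∃ N', IsOpen N' ∧ K ∪ closure N₀ᶜ ⊆ N' ∧ HasSectionOn m X N' := by
    refine hN₀.isClosed_compl.isCompact.induction_on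
      (p := fun S => ∀ K N : Set (OrbitSpace m X), IsClosed K → IsOpen N → K ⊆ N →
        HasSectionOn m X N → ∃ N', IsOpen N' ∧ K ∪ closure S ⊆ N' ∧ HasSectionOn m X N')
      ?_ ?_ ?_ ?_
    · intro K N _ hN hKN h
      exact ⟨N, hN, by simpa using hKN, h⟩
    · intro S T hST h K N hK hN hKN hs
      obtain ⟨N', hN', hsub, hs'⟩ := h K N hK hN hKN hs
      exact ⟨N', hN', (union_subset_union_right K (closure_mono hST)).trans hsub, hs'⟩
    · intro S T hS hT K N hK hN hKN hs
      obtain ⟨N₁, hN₁, hsub₁, hs₁⟩ := hS K N hK hN hKN hs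
      obtain ⟨N₂, hN₂, hsub₂, hs₂⟩ := hT _ N₁ (hK.union isClosed_closure) hN₁ hsub₁ hs₁
      refine ⟨N₂, hN₂, ?_, hs₂⟩
      rwa [closure_union, ← union_assoc]
    · intro q hq
      obtain ⟨x, rfl⟩ := hπ.surjective q
      have hx : x ∉ singularPart m X := fun h => hq (hVN₀ (mem_image_of_mem _ h))
      obtain ⟨t, ht, h⟩ := exists_nhds_hasSectionOn_union hX hx
      exact ⟨t, mem_nhdsWithin_of_mem_nhds ht, h⟩
  obtain ⟨N', -, hsub, s, hs, hsπ⟩ := hind _ N isClosed_closure hN hN₀N hsN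
  have huniv : ∀ q, q ∈ N' := fun q => hsub (by
    by_cases hq : q ∈ N₀
    · exact Or.inl (subset_closure hq)
    · exact Or.inr (subset_closure hq))
  exact ⟨s, continuousOn_univ.mp (hs.mono fun q _ => huniv q), fun q => hsπ q (huniv q)⟩

end Sections

section Classification

universe u v

/-! ### Vanishing of the Chern class -/

/-- With a section, all the choices made in the definition of the obstruction cocycle can be
obtained by composing with it, and then the cocycle is zero. -/
theorem isFreeChernClass_zero {m : ℕ} {X : Type u} [TopologicalSpace X]
    [MulAction (Torus m) X] {s : OrbitSpace m X → X} (hs : Continuous s)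
    (hsπ : ∀ q, orbitProj m (s q) = q) (l n : ℕ) : IsFreeChernClass l n m X 0 := by
  let s' : C(topPart (l + n) (orbitSpaceSkel l n m X), X) := ⟨fun b => s b, by fun_prop⟩
  refine ⟨0, ⟨s', fun σ => s'.comp σ, fun b => hsπ b, fun σ => ⟨fun x => hsπ _, fun _ => rfl⟩,
    fun τ => ⟨s'.comp τ, fun _ => 0, fun x => hsπ _, fun i x => ?_, fun j => ?_⟩⟩, rfl⟩
  · have : torusExp (0 : Fin m → ℝ) = 1 := by
      funext j
      simp [torusExp]
    exact (by rw [ContinuousMap.zero_apply, this, one_smul]; rfl)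
  · simp

/-! ### Isotropy groups and the characteristic functor -/

theorem smul_eq_self_iff_of_orbitProj_eq {m : ℕ} {X : Type u} [MulAction (Torus m) X] {x y : X}
    (h : orbitProj m x = orbitProj m y) (t : Torus m) : t • x = x ↔ t • y = y := by
  obtain ⟨a, rfl⟩ := orbitProj_eq_iff.mp h
  rw [smul_smul, mul_comm, mul_smul]
  exact (MulAction.injective a).eq_iff

theorem mem_fixingSubgroup_preimage_orbitProj_singleton {m : ℕ} {X : Type u}
    [MulAction (Torus m) X] {x : X} {t : Torus m} :
    t ∈ fixingSubgroup (Torus m) (orbitProj m ⁻¹' {orbitProj m x}) ↔ t • x = x := by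
  rw [mem_fixingSubgroup_iff]
  exact ⟨fun h => h x rfl, fun h y hy => (smul_eq_self_iff_of_orbitProj_eq hy t).mpr h⟩

section Strata

variable {m : ℕ} {X : Type u} [TopologicalSpace X] [MulAction (Torus m) X]

theorem orbitSpaceSkel_zero (m : ℕ) (X : Type u) [MulAction (Torus m) X] :
    orbitSpaceSkel 0 1 m X 0 = orbitProj m '' singularPart m X := by
  simp [orbitSpaceSkel, singularPart]

theorem mem_singularPart_of_orbitProj_mem [ContinuousSMul (Torus m) X]
    (hX : IsLocallyStandard 0 1 m X) {x : X} (h : orbitProj m x ∈ orbitSpaceSkel 0 1 m X 0) :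
    x ∈ singularPart m X := by
  rw [orbitSpaceSkel_zero] at h
  obtain ⟨y, hy, hyx⟩ := h
  rw [← exists_smul_eq_iff_mem_singularPart hX] at hy ⊢
  obtain ⟨t, ht, ht1⟩ := hy
  exact ⟨t, (smul_eq_self_iff_of_orbitProj_eq hyx t).mp ht, ht1⟩

/-- A vertex of the graph is a stratum, as there are only finitely many of them. -/
theorem exists_strata_eq_singleton [T2Space X] [ContinuousSMul (Torus m) X]
    (hX : IsLocallyStandard 0 1 m X) {x : X} (hx : x ∈ singularPart m X) :
    ∃ S : Strata (orbitSpaceSkel 0 1 m X), S.1 = {orbitProj m x} := by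
  have := t2Space_orbitSpace m X
  have hneg : orbitSpaceSkel 0 1 m X (0 - 1) = ∅ := by
    rw [orbitSpaceSkel, orbitSkel_eq_empty hX (by push_cast; linarith), image_empty]
  have hmem : orbitProj m x ∈ orbitSpaceSkel 0 1 m X 0 \ orbitSpaceSkel 0 1 m X (0 - 1) := by
    rw [hneg, sdiff_empty, orbitSpaceSkel_zero]
    exact mem_image_of_mem _ hx
  refine ⟨⟨{orbitProj m x}, 0, orbitProj m x, hmem, ?_⟩, rfl⟩
  refine (Set.Subsingleton.eq_singleton_of_mem ?_ (mem_connectedComponentIn hmem)).symm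
  refine not_nontrivial_iff.mp fun h =>
    isPreconnected_connectedComponentIn.infinite_of_nontrivial h
      ((finite_image_singularPart hX).subset ((connectedComponentIn_subset _ _).trans ?_))
  rw [orbitSpaceSkel_zero]
  exact sdiff_subset

end Strata

theorem OrbitDimLE.of_smul_eq_iff {m : ℕ} {X : Type u} {X' : Type v} [MulAction (Torus m) X]
    [MulAction (Torus m) X'] (ψ : Torus m ≃ₜ* Torus m) {x : X} {x' : X'}
    (h : ∀ t : Torus m, t • x = x ↔ ψ t • x' = x') {d : ℤ} (hd : OrbitDimLE m x d) :
    OrbitDimLE m x' d := by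
  obtain ⟨r, ⟨e⟩, hr⟩ := hd
  let e' : MulAction.stabilizer (Torus m) x' ≃ₜ* MulAction.stabilizer (Torus m) x :=
    { toFun := fun t => ⟨ψ.symm t, (h _).mpr (by rw [ψ.apply_symm_apply]; exact t.2)⟩
      invFun := fun t => ⟨ψ t, (h _).mp t.2⟩
      left_inv := fun t => Subtype.ext (ψ.apply_symm_apply _)
      right_inv := fun t => Subtype.ext (ψ.symm_apply_apply _)
      map_mul' := fun t t' => Subtype.ext (map_mul ψ.symm _ _)
      continuous_toFun := (ψ.symm.continuous.comp continuous_subtype_val).subtype_mk _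
      continuous_invFun := (ψ.continuous.comp continuous_subtype_val).subtype_mk _ }
  exact ⟨r, ⟨e'.trans e⟩, hr⟩

/-! ### From equivariant homeomorphisms to characteristic data and back -/

section Homeomorphisms

variable {m : ℕ} {X : Type u} {X' : Type v} [TopologicalSpace X] [TopologicalSpace X']
  [MulAction (Torus m) X] [MulAction (Torus m) X']

/-- The homeomorphism of orbit spaces induced by a weakly equivariant homeomorphism. -/
noncomputable def orbitSpaceHomeo (h : X ≃ₜ X') (ψ : Torus m ≃ₜ* Torus m)
    (hψ : ∀ (t : Torus m) (x : X), h (t • x) = ψ t • h x) :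
    OrbitSpace m X ≃ₜ OrbitSpace m X' where
  toFun := Quotient.map h (by
    rintro _ y ⟨t, rfl⟩
    exact ⟨ψ t, (hψ t y).symm⟩)
  invFun := Quotient.map h.symm (by
    rintro _ y ⟨t, rfl⟩
    refine ⟨ψ.symm t, h.injective ?_⟩
    simp [hψ])
  left_inv := by
    rintro ⟨x⟩
    exact congrArg (orbitProj m) (h.symm_apply_apply x)
  right_inv := by
    rintro ⟨x⟩
    exact congrArg (orbitProj m) (h.apply_symm_apply x)
  continuous_toFun := h.continuous.quotient_map' _
  continuous_invFun := h.symm.continuous.quotient_map' _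

theorem exists_isIso_of_homeomorph [T2Space X] [T2Space X'] [ContinuousSMul (Torus m) X]
    [ContinuousSMul (Torus m) X'] (l n : ℕ) (h : X ≃ₜ X') (ψ : Torus m ≃ₜ* Torus m)
    (hψ : ∀ (t : Torus m) (x : X), h (t • x) = ψ t • h x) :
    ∃ f : OrbitSpace m X ≃ₜ OrbitSpace m X',
      (charData l n m X 0).IsIso (charData l n m X' 0) f ψ := by
  have hstab : ∀ (t : Torus m) (x : X), t • x = x ↔ ψ t • h x = h x := fun t x => by
    rw [← hψ, h.injective.eq_iff]
  have hskel : ∀ k, h '' orbitSkel l n m X k = orbitSkel l n m X' k := by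
    intro k
    ext y
    constructor
    · rintro ⟨x, ⟨i, hi, hd⟩, rfl⟩
      exact ⟨i, hi, hd.of_smul_eq_iff ψ (fun t => hstab t x)⟩
    · rintro ⟨i, hi, hd⟩
      refine ⟨h.symm y, ⟨i, hi, hd.of_smul_eq_iff ψ.symm (fun t => ?_)⟩, h.apply_symm_apply y⟩
      rw [hstab, ψ.apply_symm_apply, h.apply_symm_apply]
  have hf : IsStratifiedHomeo (orbitSpaceSkel l n m X) (orbitSpaceSkel l n m X')
      (orbitSpaceHomeo h ψ hψ) := by
    intro k
    unfold orbitSpaceSkel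
    rw [← hskel, image_image, image_image]
    rfl
  refine ⟨orbitSpaceHomeo h ψ hψ, hf, (map_zero _).symm, fun S => ?_⟩
  ext t
  change t ∈ (fixingSubgroup (Torus m) (orbitProj m ⁻¹' S.1)).map (ψ : Torus m →* Torus m) ↔
    t ∈ fixingSubgroup (Torus m) (orbitProj m ⁻¹' (orbitSpaceHomeo h ψ hψ '' S.1))
  rw [Subgroup.mem_map, mem_fixingSubgroup_iff]
  constructor
  · rintro ⟨t, ht, rfl⟩ y ⟨q, hq, hqy⟩
    obtain ⟨x, rfl⟩ := h.surjective y
    have hqx : q = orbitProj m x := (orbitSpaceHomeo h ψ hψ).injective hqy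
    exact (hstab t x).mp ((mem_fixingSubgroup_iff _).mp ht x (by rwa [mem_preimage, ← hqx]))
  · intro ht
    refine ⟨ψ.symm t, (mem_fixingSubgroup_iff _).mpr fun x hx => ?_, ψ.apply_symm_apply t⟩
    rw [hstab, ψ.apply_symm_apply]
    exact ht _ ⟨_, hx, rfl⟩

/-- A space with a compact Hausdorff torus action whose orbit map has a section is a quotient of
`T × Q`, so it can be rebuilt from its orbit space and the isotropy groups along the section. -/
theorem exists_homeomorph_of_section [T2Space X] [CompactSpace X] [T2Space X']
    [ContinuousSMul (Torus m) X] [ContinuousSMul (Torus m) X']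
    {s : OrbitSpace m X → X} (hs : Continuous s) (hsπ : ∀ q, orbitProj m (s q) = q)
    {s' : OrbitSpace m X' → X'} (hs' : Continuous s') (hsπ' : ∀ q, orbitProj m (s' q) = q)
    (f : OrbitSpace m X ≃ₜ OrbitSpace m X') (ψ : Torus m ≃ₜ* Torus m)
    (hstab : ∀ q (t : Torus m), t • s q = s q ↔ ψ t • s' (f q) = s' (f q)) :
    ∃ h : X ≃ₜ X', ∀ (t : Torus m) (x : X), h (t • x) = ψ t • h x := by
  have hπ := isOpenQuotientMap_orbitProj m X
  have : CompactSpace (OrbitSpace m X) := hπ.surjective.compactSpace hπ.continuous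
  let Φ : C(Torus m × OrbitSpace m X, X) :=
    ⟨fun p => p.1 • s p.2, continuous_fst.smul (hs.comp continuous_snd)⟩
  let Φ' : C(Torus m × OrbitSpace m X, X') :=
    ⟨fun p => ψ p.1 • s' (f p.2), (ψ.continuous.comp continuous_fst).smul (by fun_prop)⟩
  have hΦsurj : Function.Surjective Φ := by
    intro x
    obtain ⟨t, ht⟩ := orbitProj_eq_iff.mp (hsπ (orbitProj m x)).symm
    exact ⟨(t, orbitProj m x), ht⟩
  have hΦquot : IsQuotientMap Φ := Φ.continuous.isClosedMap.isQuotientMap Φ.continuous hΦsurj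
  have hfib : ∀ a b, Φ a = Φ b ↔ Φ' a = Φ' b := by
    rintro ⟨a, q⟩ ⟨b, r⟩
    have key : ∀ a b q, Φ (a, q) = Φ (b, q) ↔ Φ' (a, q) = Φ' (b, q) := by
      intro a b q
      change a • s q = b • s q ↔ ψ a • s' (f q) = ψ b • s' (f q)
      rw [← inv_smul_eq_iff, smul_smul, hstab, map_mul, map_inv, mul_smul, inv_smul_eq_iff]
    have h1 : Φ (a, q) = Φ (b, r) → q = r := fun h => by
      rw [← hsπ q, ← hsπ r, ← orbitProj_smul a (s q), ← orbitProj_smul b (s r)]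
      exact congrArg _ h
    have h2 : Φ' (a, q) = Φ' (b, r) → q = r := fun h => by
      refine f.injective ?_
      rw [← hsπ' (f q), ← hsπ' (f r), ← orbitProj_smul (ψ a), ← orbitProj_smul (ψ b) (s' (f r))]
      exact congrArg _ h
    constructor
    · intro h
      obtain rfl := h1 h
      exact (key a b q).mp h
    · intro h
      obtain rfl := h2 h
      exact (key a b q).mpr h
  let H : C(X, X') := hΦquot.lift Φ' fun a b => (hfib a b).mp
  have hH : ∀ p, H (Φ p) = Φ' p := fun p =>
    DFunLike.congr_fun (hΦquot.lift_comp Φ' fun a b => (hfib a b).mp) p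
  have hHbij : Function.Bijective H := by
    constructor
    · intro x y hxy
      obtain ⟨a, rfl⟩ := hΦsurj x
      obtain ⟨b, rfl⟩ := hΦsurj y
      rw [hH, hH] at hxy
      exact (hfib a b).mpr hxy
    · intro y
      obtain ⟨t, ht⟩ := orbitProj_eq_iff.mp (hsπ' (orbitProj m y)).symm
      refine ⟨Φ (ψ.symm t, f.symm (orbitProj m y)), ?_⟩
      rw [hH]
      simpa [Φ'] using ht
  have hhom := isHomeomorph_iff_continuous_bijective.mpr ⟨H.continuous, hHbij⟩
  refine ⟨hhom.homeomorph, fun t x => ?_⟩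
  obtain ⟨⟨a, q⟩, rfl⟩ := hΦsurj x
  change H (t • a • s q) = ψ t • H (Φ (a, q))
  rw [smul_smul, show (t * a) • s q = Φ (t * a, q) from rfl, hH, hH]
  change ψ (t * a) • s' (f q) = ψ t • ψ a • s' (f q)
  rw [map_mul, mul_smul]

/-- An isomorphism of characteristic data matches isotropy groups: over the vertices this is the
condition on the characteristic functors, and elsewhere both actions are free. -/
theorem smul_eq_self_iff_of_isIso [T2Space X] [T2Space X'] [ContinuousSMul (Torus m) X]
    [ContinuousSMul (Torus m) X'] (hX : IsLocallyStandard 0 1 m X)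
    (hX' : IsLocallyStandard 0 1 m X') {f : OrbitSpace m X ≃ₜ OrbitSpace m X'}
    {ψ : Torus m ≃ₜ* Torus m} (hf : (charData 0 1 m X 0).IsIso (charData 0 1 m X' 0) f ψ)
    {x : X} {x' : X'} (hx : f (orbitProj m x) = orbitProj m x') (t : Torus m) :
    t • x = x ↔ ψ t • x' = x' := by
  obtain ⟨hfs, -, hchar⟩ := hf
  have hiff : x ∈ singularPart m X ↔ x' ∈ singularPart m X' := by
    have h0 : f '' orbitSpaceSkel 0 1 m X 0 = orbitSpaceSkel 0 1 m X' 0 := hfs 0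
    constructor
    · intro h
      refine mem_singularPart_of_orbitProj_mem hX' ?_
      rw [← h0, ← hx, orbitSpaceSkel_zero]
      exact mem_image_of_mem _ (mem_image_of_mem _ h)
    · intro h
      refine mem_singularPart_of_orbitProj_mem hX ?_
      have h1 : orbitProj m x' ∈ f '' orbitSpaceSkel 0 1 m X 0 := by
        rw [h0, orbitSpaceSkel_zero]
        exact mem_image_of_mem _ h
      rwa [← hx, f.injective.mem_set_image] at h1
  by_cases hxs : x ∈ singularPart m X
  · obtain ⟨S, hS⟩ := exists_strata_eq_singleton hX hxs
    have h : (fixingSubgroup (Torus m) (orbitProj m ⁻¹' S.1)).map (ψ : Torus m →* Torus m) =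
        fixingSubgroup (Torus m) (orbitProj m ⁻¹' (f '' S.1)) := hchar S
    rw [hS, image_singleton, hx] at h
    rw [← mem_fixingSubgroup_preimage_orbitProj_singleton (x := x'), ← h,
      ← mem_fixingSubgroup_preimage_orbitProj_singleton (x := x)]
    exact (Subgroup.mem_map_iff_mem (f := (ψ : Torus m →* Torus m)) ψ.injective).symm
  · have hxs' : x' ∉ singularPart m X' := fun h => hxs (hiff.mpr h)
    rw [← exists_smul_eq_iff_mem_singularPart hX] at hxs
    rw [← exists_smul_eq_iff_mem_singularPart hX'] at hxs'
    push Not at hxs hxs'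
    constructor
    · intro h
      rw [hxs t h, map_one, one_smul]
    · intro h
      rw [ψ.injective ((hxs' _ h).trans (map_one ψ).symm), one_smul]

/-- The classification for a fixed automorphism `ψ` of the torus. -/
theorem exists_isIso_iff_exists_homeomorph [T2Space X] [T2Space X'] [ContinuousSMul (Torus m) X]
    [ContinuousSMul (Torus m) X'] (hX : IsLocallyStandard 0 1 m X)
    (hX' : IsLocallyStandard 0 1 m X') (ψ : Torus m ≃ₜ* Torus m) :
    (∃ f : OrbitSpace m X ≃ₜ OrbitSpace m X',
      (charData 0 1 m X 0).IsIso (charData 0 1 m X' 0) f ψ) ↔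
    ∃ h : X ≃ₜ X', ∀ (t : Torus m) (x : X), h (t • x) = ψ t • h x := by
  refine ⟨fun ⟨f, hf⟩ => ?_, fun ⟨h, hψ⟩ => exists_isIso_of_homeomorph 0 1 h ψ hψ⟩
  have : CompactSpace X := by
    rw [IsLocallyStandard] at hX
    exact hX.2.1
  obtain ⟨s, hs, hsπ⟩ := exists_continuous_section hX
  obtain ⟨s', hs', hsπ'⟩ := exists_continuous_section hX'
  exact exists_homeomorph_of_section hs hsπ hs' hsπ' f ψ fun q t =>
    smul_eq_self_iff_of_isIso hX hX' hf (by rw [hsπ, hsπ']) t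

end Homeomorphisms

end Classification

theorem mainTheorem1 (m : ℕ) (X X' : Type*)
    [TopologicalSpace X] [T2Space X] [ConnectedSpace X]
    [MulAction (Torus m) X] [ContinuousSMul (Torus m) X]
    [TopologicalSpace X'] [T2Space X'] [ConnectedSpace X']
    [MulAction (Torus m) X'] [ContinuousSMul (Torus m) X']
    (hX : IsLocallyStandard 0 1 m X) (hX' : IsLocallyStandard 0 1 m X') :
    IsFreeChernClass 0 1 m X 0 ∧ IsFreeChernClass 0 1 m X' 0 ∧
    ((charData 0 1 m X 0).Isomorphic (charData 0 1 m X' 0) ↔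
      EquivariantlyHomeomorphic m X X') ∧
    ((charData 0 1 m X 0).WeaklyIsomorphic (charData 0 1 m X' 0) ↔
      WeaklyEquivariantlyHomeomorphic m X X') := by
  obtain ⟨s, hs, hsπ⟩ := exists_continuous_section hX
  obtain ⟨s', hs', hsπ'⟩ := exists_continuous_section hX'
  refine ⟨isFreeChernClass_zero hs hsπ 0 1, isFreeChernClass_zero hs' hsπ' 0 1,
    exists_isIso_iff_exists_homeomorph hX hX' (ContinuousMulEquiv.refl _), ?_⟩
  unfold CharData.WeaklyIsomorphic WeaklyEquivariantlyHomeomorphic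
  rw [exists_comm, exists_comm (α := X ≃ₜ X')]
  exact exists_congr fun ψ => exists_isIso_iff_exists_homeomorph hX hX' ψ
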